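/- For a finite simple graph $\Gamma$ with vertices $1,\dots,r$ and adjacency matrix $A_\Gamma$, let $$H_\Gamma(q)=\sum_{\mathbf n=(n_1,\dots,n_r)\in\mathbb{Z}_{\ge 0}^r}\frac{q^{\frac12\mathbf n A_\Gamma\mathbf n^T+n_1+\cdots+n_r}}{(q)_{n_1}\cdots(q)_{n_r}}$$ be its graph series, a formal power series in $q$, where $(q)_n=\prod_{i=1}^n(1-q^i)$ and $(q)_\infty=\prod_{i\ge1}(1-q^i)$. Identities below are between formal (Laurent) series in $q$. (i) For $k\ge 1$, let $\Gamma_{3k+2}$ be the graph with vertices $1,\dots,3k+2$ and the following edges: $1\sim2\sim3\sim4\sim5\sim1$; $i\sim i+1$ for $5\le i\le 3k+1$; $1\sim 3t+2$ and $4\sim 3t+2$ for $2\le t\le k$; and $3s+1\sim 3(\ell+1)+2$ for $2\le s\le\ell\le k-1$. Then $$H_{\Gamma_{3k+2}}(q)=q^{-1}\,\frac{\displaystyle\sum_{n\ge1}\frac{n\binom{n+k-2}{k-1}q^n}{1-q^n}}{(q)_\infty^{k+1}}.$$ Moreover, the numerator $\sum_{n\ge1}\frac{n\binom{n+k-2}{k-1}q^n}{1-q^n}$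 is the logarithmic derivative $\frac{1}{M}\,q\frac{d}{dq}M$, with respect to $q\frac{d}{dq}$, of MacMahon's $(k+1)$-dimensional generating series $$M(q)=\frac{1}{\prod_{n\ge1}(1-q^n)^{\binom{n+k-2}{k-1}}}.$$ (ii) For $k\ge2$, let $T_{2k+2}$ be the $(k+1)$-star graph with $k$ legs of length two and one leg of length one, that is, the graph with vertices $1,\dots,2k+2$ and edges $1\sim 2i$, $2i\sim 2i+1$ for $1\le i\le k$, and $1\sim 2k+2$. Then $$H_{T_{2k+2}}(q)=q^{-1}\,\frac{\mathfrak z_q(k)}{(q)_\infty^{k+1}},\qquad\text{where}\quad \mathfrak z_q(k)=\sum_{n\ge1}\frac{q^n}{(1-q^n)^k}=\sum_{n\ge1}\frac{\binom{n+k-2}{k-1}q^n}{1-q^n}.$$ -/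

import Mathlib

/-! Formal `q`-series are elements of `ℚ⟦X⟧`, with `X` in the role of `q`. Infinite sums and products
are Mathlib's `∑'` and `∏'` for the topology of coefficientwise convergence. -/

open PowerSeries
open scoped PowerSeries.WithPiTopology

namespace GraphSeries

/-- The finite `q`-Pochhammer symbol `(q)_n = (1 - q)(1 - q²)⋯(1 - qⁿ)`. -/
noncomputable def qPoch (n : ℕ) : ℚ⟦X⟧ :=
  ∏ i ∈ Finset.range n, (1 - X ^ (i + 1))

/-- The infinite `q`-Pochhammer symbol `(q)_∞ = ∏_{n ≥ 1} (1 - qⁿ)`. -/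
noncomputable def qPochInf : ℚ⟦X⟧ :=
  ∏' i : ℕ, (1 - X ^ (i + 1))

open scoped Classical in
/-- The quadratic form `½ n A nᵀ` of a graph with adjacency matrix `A`; the division by two is exact,
see `two_mul_quadForm`. -/
noncomputable def quadForm {V : Type*} [Fintype V] (G : SimpleGraph V) (n : V → ℕ) : ℕ :=
  (n ⬝ᵥ (G.adjMatrix ℕ).mulVec n) / 2

/-- The term `q^{½ n A nᵀ + n_1 + ⋯ + n_r} / ((q)_{n_1} ⋯ (q)_{n_r})` of the graph series. The
denominator has constant term one, so that `⁻¹` is its true inverse in `ℚ⟦X⟧`. -/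
noncomputable def graphSeriesTerm {V : Type*} [Fintype V] (G : SimpleGraph V) (n : V → ℕ) :
    ℚ⟦X⟧ :=
  X ^ (quadForm G n + ∑ v, n v) * (∏ v, qPoch (n v))⁻¹

/-- The graph series `H_Γ(q)`, in the standard framing `b = (1, …, 1)`. -/
noncomputable def graphSeries {V : Type*} [Fintype V] (G : SimpleGraph V) : ℚ⟦X⟧ :=
  ∑' n : V → ℕ, graphSeriesTerm G n

/-- The leafless graph `Γ_{3k+2}`. The vertex labelled `a ∈ {1, …, 3k+2}` is the element `a - 1` of
`Fin (3 * k + 2)`. Each edge is listed in one direction, `SimpleGraph.fromRel` symmetrizes. -/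
def leafless (k : ℕ) : SimpleGraph (Fin (3 * k + 2)) :=
  SimpleGraph.fromRel fun i j =>
    let a := (i : ℕ) + 1
    let b := (j : ℕ) + 1
    -- the pentagon 1 ∼ 2 ∼ 3 ∼ 4 ∼ 5 ∼ 1
    (a ≤ 4 ∧ b = a + 1) ∨ (a = 5 ∧ b = 1) ∨
    -- the path 5 ∼ 6 ∼ ⋯ ∼ 3k + 2
    (5 ≤ a ∧ a ≤ 3 * k + 1 ∧ b = a + 1) ∨
    -- 1 ∼ 3t + 2 and 4 ∼ 3t + 2 for 2 ≤ t ≤ k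
    (∃ t ∈ Finset.Icc 2 k, (a = 1 ∨ a = 4) ∧ b = 3 * t + 2) ∨
    -- 3s + 1 ∼ 3(l + 1) + 2 for 2 ≤ s ≤ l ≤ k - 1
    (∃ l ∈ Finset.range k, ∃ s ∈ Finset.Icc 2 l, a = 3 * s + 1 ∧ b = 3 * (l + 1) + 2)

/-- The `(k+1)`-star graph `T_{2k+2}`: a centre with `k` legs of length two and one leg of length
one. The vertex labelled `a ∈ {1, …, 2k+2}` is the element `a - 1` of `Fin (2 * k + 2)`; the centre
is `1`, the long legs are `1 ∼ 2i ∼ 2i + 1` for `1 ≤ i ≤ k`, the short leg is `1 ∼ 2k + 2`. -/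
def starGraph (k : ℕ) : SimpleGraph (Fin (2 * k + 2)) :=
  SimpleGraph.fromRel fun i j =>
    let a := (i : ℕ) + 1
    let b := (j : ℕ) + 1
    (∃ m ∈ Finset.Icc 1 k, (a = 1 ∧ b = 2 * m) ∨ (a = 2 * m ∧ b = 2 * m + 1)) ∨
    (a = 1 ∧ b = 2 * k + 2)

/-- The terms of `macMahonNumerator`, with `n + 1` in place of `n`. -/
noncomputable def macMahonNumeratorTerm (k n : ℕ) : ℚ⟦X⟧ :=
  C (((n + 1) * (n + k - 1).choose (k - 1) : ℕ) : ℚ) * X ^ (n + 1) * (1 - X ^ (n + 1))⁻¹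

/-- `∑_{n ≥ 1} n * binom (n + k - 2) (k - 1) * qⁿ / (1 - qⁿ)`, for `k ≥ 1`. -/
noncomputable def macMahonNumerator (k : ℕ) : ℚ⟦X⟧ :=
  ∑' n : ℕ, macMahonNumeratorTerm k n

/-- MacMahon's `(k+1)`-dimensional generating series
`1 / ∏_{n ≥ 1} (1 - qⁿ) ^ binom (n + k - 2) (k - 1)`, for `k ≥ 1`. -/
noncomputable def macMahon (k : ℕ) : ℚ⟦X⟧ :=
  (∏' n : ℕ, (1 - X ^ (n + 1)) ^ (n + k - 1).choose (k - 1))⁻¹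

/-- The logarithmic derivative with respect to `q d/dq`, for series with nonzero constant term. -/
noncomputable def qLogDeriv (f : ℚ⟦X⟧) : ℚ⟦X⟧ :=
  X * derivative ℚ f * f⁻¹

/-- The terms of `qZeta`, with `n + 1` in place of `n`. -/
noncomputable def qZetaTerm (k n : ℕ) : ℚ⟦X⟧ :=
  X ^ (n + 1) * ((1 - X ^ (n + 1)) ^ k)⁻¹

/-- The `q`-zeta value `𝔷_q(k) = ∑_{n ≥ 1} qⁿ / (1 - qⁿ)ᵏ`. -/
noncomputable def qZeta (k : ℕ) : ℚ⟦X⟧ :=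
  ∑' n : ℕ, qZetaTerm k n

/-- The terms of `qZetaLambert`, with `n + 1` in place of `n`. -/
noncomputable def qZetaLambertTerm (k n : ℕ) : ℚ⟦X⟧ :=
  C (((n + k - 1).choose (k - 1) : ℕ) : ℚ) * X ^ (n + 1) * (1 - X ^ (n + 1))⁻¹

/-- The Lambert series `∑_{n ≥ 1} binom (n + k - 2) (k - 1) * qⁿ / (1 - qⁿ)`, for `k ≥ 1`. -/
noncomputable def qZetaLambert (k : ℕ) : ℚ⟦X⟧ :=
  ∑' n : ℕ, qZetaLambertTerm k n

/-! The definitions above make sense: divisions are exact, and all sums and products converge. -/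

open scoped Classical in
theorem two_mul_quadForm {V : Type*} [Fintype V] (G : SimpleGraph V) (n : V → ℕ) :
    2 * quadForm G n = n ⬝ᵥ (G.adjMatrix ℕ).mulVec n := by
  refine Nat.mul_div_cancel' ?_
  rw [← ZMod.natCast_eq_zero_iff]
  simp only [dotProduct, Matrix.mulVec, Finset.mul_sum, Nat.cast_sum]
  rw [← Finset.sum_product']
  refine Finset.sum_involution (fun p _ => (p.2, p.1)) ?_ ?_ ?_ ?_
  · rintro ⟨i, j⟩ -
    have h : n j * (G.adjMatrix ℕ j i * n i) = n i * (G.adjMatrix ℕ i j * n j) := by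
      simp only [SimpleGraph.adjMatrix_apply, G.adj_comm j i]; ring
    simp only [h]
    exact CharTwo.add_self_eq_zero _
  · rintro ⟨i, j⟩ - h1 h2
    simp only [Prod.mk.injEq] at h2
    obtain ⟨rfl, -⟩ := h2
    simp at h1
  · simp
  · simp

/-- A family whose coefficients of each degree are finitely supported is summable. -/
theorem summable_of_finite {ι : Type*} (f : ι → ℚ⟦X⟧)
    (h : ∀ d, {i | coeff d (f i) ≠ 0}.Finite) : Summable f := by
  rw [WithPiTopology.summable_iff_summable_coeff]
  exact fun d => summable_of_hasFiniteSupport (h d)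

theorem summable_graphSeriesTerm {V : Type*} [Fintype V] (G : SimpleGraph V) :
    Summable (graphSeriesTerm G) := by
  classical
  refine summable_of_finite _ fun d => ?_
  refine (Set.finite_Iic (fun _ : V => d)).subset fun n hn v => ?_
  by_contra hv
  refine hn ?_
  replace hv : ¬ n v ≤ d := hv
  have h1 : n v ≤ ∑ w, n w := Finset.single_le_sum (f := n) (by simp) (Finset.mem_univ v)
  simp only [graphSeriesTerm, coeff_X_pow_mul']
  rw [if_neg (by omega)]

theorem summable_X_pow_mul (g : ℕ → ℚ⟦X⟧) : Summable fun n => X ^ (n + 1) * g n := by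
  refine summable_of_finite _ fun d => ?_
  refine (Set.finite_Iic d).subset fun n hn => ?_
  by_contra hv
  refine hn ?_
  simp only [Set.mem_Iic, not_le] at hv
  simp only [coeff_X_pow_mul']
  rw [if_neg (by omega)]

theorem summable_macMahonNumeratorTerm (k : ℕ) : Summable (macMahonNumeratorTerm k) :=
  (summable_X_pow_mul fun n => C (((n + 1) * (n + k - 1).choose (k - 1) : ℕ) : ℚ) *
    (1 - X ^ (n + 1))⁻¹).congr fun n => by rw [macMahonNumeratorTerm]; ring

theorem summable_qZetaTerm (k : ℕ) : Summable (qZetaTerm k) :=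
  summable_X_pow_mul fun n => ((1 - X ^ (n + 1)) ^ k)⁻¹

theorem summable_qZetaLambertTerm (k : ℕ) : Summable (qZetaLambertTerm k) :=
  (summable_X_pow_mul fun n => C (((n + k - 1).choose (k - 1) : ℕ) : ℚ) *
    (1 - X ^ (n + 1))⁻¹).congr fun n => by rw [qZetaLambertTerm]; ring

theorem multipliable_one_sub_X_pow_pow (c : ℕ → ℕ) :
    Multipliable fun n : ℕ => ((1 : ℚ⟦X⟧) - X ^ (n + 1)) ^ c n := by
  have h (n : ℕ) : ∃ g : ℚ⟦X⟧, ((1 : ℚ⟦X⟧) - X ^ (n + 1)) ^ c n = 1 + X ^ (n + 1) * g := by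
    have h1 := sub_dvd_pow_sub_pow ((1 : ℚ⟦X⟧) - X ^ (n + 1)) 1 (c n)
    rw [one_pow, sub_sub_cancel_left, neg_dvd] at h1
    obtain ⟨g, hg⟩ := h1
    exact ⟨g, by rw [← hg]; ring⟩
  choose g hg using h
  simp only [hg]
  refine WithPiTopology.multipliable_one_add_of_tendsto_order_atTop_nhds_top ℚ ?_
  refine ENat.tendsto_nhds_top_iff_natCast_lt.mpr fun n =>
    Filter.eventually_atTop.mpr ⟨n, fun m hm => ?_⟩
  refine lt_of_lt_of_le ?_ (le_order_mul _ _)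
  rw [order_X_pow]
  refine lt_of_lt_of_le ?_ le_self_add
  exact_mod_cast Nat.lt_succ_of_le hm

theorem multipliable_qPochInf : Multipliable fun n : ℕ => (1 : ℚ⟦X⟧) - X ^ (n + 1) := by
  simpa using multipliable_one_sub_X_pow_pow fun _ => 1

end GraphSeries

/-!
Summing a graph series over a variable `a` attached to a vertex whose neighbours carry variables of
sum `N` gives Euler's series `∑ₐ q^{a (N + 1)} / (q)ₐ = (q)_N / (q)_∞`.

For the star graph, this eliminates first the ends of the long legs and then the short leg. The sum
over a neighbour of the centre becomes geometric, and what remains is the `q`-zeta value divided by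
`q (q)_∞^{k + 1}`. The Lambert form of the `q`-zeta value is the negative binomial series followed
by an exchange of summations.

The leafless graph has, after relabelling, vertices `b_0, …, b_k`, `c_0, …, c_k` and
`a_0, …, a_{k - 1}`, with edges `b_s ∼ c_t` for `s ≤ t`, `a_s ∼ c_s` and `a_s ∼ b_{s + 1}`. Summing
over the `a_s` (Euler), over `b_0` (Euler) and over the other `b_s` (the `q`-binomial theorem,
`binomialSum_mul`) leaves Pochhammer symbols which telescope (`leaflessSum_eq`). The result is
`(q)_∞^{-(k + 1)}` times the sum over chains `C_0 ≥ ⋯ ≥ C_k ≥ 0` of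
`q^{C_0} / ((1 - q^{C_0 + 1}) ⋯ (1 - q^{C_{k - 1} + 1}))`.

To evaluate it, let `J_k(e)` be the part of the sum with `C_k = e`. Then `J_0(e) = q^e` and
`J_{k + 1}(e) = ∑_{j ≥ e} J_k(j) / (1 - q^{j + 1})`. The polynomials `Q_n(e)` given by
`Q_0(e) = q^e` and `Q_{n + 1}(e) = q^{e + 1} Q_n(e) + (1 - q^{e + 1}) Q_n(e + 1)` turn this recursion
into Pascal's rule, whence `J_k(e) = ∑ₙ ((k, n)) Q_n(e)` with multiset coefficients
(`chainSum_eq_chainExpansion`). Finally `∑ₑ Q_n(e) = (n + 1) qⁿ / (1 - q^{n + 1})`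
(`tsum_chainPoly`), a special case of the closed form of the moments `∑ₑ q^{e j} Q_n(e)`.

The logarithmic derivative of MacMahon's series is computed on partial products, as `d/dq` is
continuous.
-/

namespace GraphSeries

/-! ### Summation of formal power series -/

/-- A family of power series of which only finitely many contribute to any given degree. This is
stronger than `Summable`, and passes to arbitrary subfamilies; the latter matters because `ℚ` is
not complete, so that Mathlib's results on summable families in complete groups do not apply. -/
def CoeffFinite {ι : Type*} (f : ι → ℚ⟦X⟧) : Prop :=
  ∀ d, {i | coeff d (f i) ≠ 0}.Finite

theorem CoeffFinite.summable {ι : Type*} {f : ι → ℚ⟦X⟧} (h : CoeffFinite f) : Summable f :=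
  summable_of_finite f h

theorem CoeffFinite.comp_injective {ι κ : Type*} {f : ι → ℚ⟦X⟧} (h : CoeffFinite f) {g : κ → ι}
    (hg : Function.Injective g) : CoeffFinite (f ∘ g) :=
  fun d => (h d).preimage hg.injOn

theorem CoeffFinite.tsum_prod {ι κ : Type*} {f : ι × κ → ℚ⟦X⟧} (h : CoeffFinite f) :
    ∑' p, f p = ∑' i, ∑' j, f (i, j) :=
  h.summable.tsum_prod' fun i => (h.comp_injective (Prod.mk_right_injective i)).summable

theorem CoeffFinite.tsum_comm {ι κ : Type*} {f : ι → κ → ℚ⟦X⟧}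
    (h : CoeffFinite (Function.uncurry f)) :
    ∑' i, ∑' j, f i j = ∑' j, ∑' i, f i j :=
  (h.summable.tsum_comm'
    (fun i => (h.comp_injective (Prod.mk_right_injective i)).summable)
    (fun j => (h.comp_injective (Prod.mk_left_injective j)).summable)).symm

theorem coeffFinite_of_X_pow_dvd {ι : Type*} {f : ι → ℚ⟦X⟧} (w : ι → ℕ)
    (hw : ∀ d, {i | w i ≤ d}.Finite) (h : ∀ i, X ^ w i ∣ f i) : CoeffFinite f := by
  refine fun d => (hw d).subset fun i hi => ?_
  by_contra hd
  exact hi (X_pow_dvd_iff.mp (h i) d (not_le.mp hd))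

theorem coeffFinite_nat {f : ℕ → ℚ⟦X⟧} (h : ∀ n, X ^ n ∣ f n) : CoeffFinite f :=
  coeffFinite_of_X_pow_dvd id Set.finite_Iic h

theorem coeffFinite_nat_prod {f : ℕ → ℕ → ℚ⟦X⟧} (h : ∀ m n, X ^ (m + n) ∣ f m n) :
    CoeffFinite (Function.uncurry f) := by
  refine coeffFinite_of_X_pow_dvd (fun p => p.1 + p.2) (fun d => ?_) fun p => h p.1 p.2
  refine (Set.finite_Iic (d, d)).subset fun p (hp : p.1 + p.2 ≤ d) => ?_
  exact ⟨by dsimp only; omega, by dsimp only; omega⟩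

theorem finite_sum_le {V : Type*} [Fintype V] (d : ℕ) : {n : V → ℕ | ∑ v, n v ≤ d}.Finite := by
  classical
  exact (Set.finite_Iic fun _ : V => d).subset fun n hn v =>
    (Finset.single_le_sum (f := n) (by simp) (Finset.mem_univ v)).trans hn

theorem coeffFinite_pi {V : Type*} [Fintype V] {f : (V → ℕ) → ℚ⟦X⟧}
    (h : ∀ n, X ^ (∑ v, n v) ∣ f n) : CoeffFinite f :=
  coeffFinite_of_X_pow_dvd _ finite_sum_le h

/-- A sum over `ℕⁿ` of products of functions of one coordinate is a product of sums. -/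
theorem tsum_pi_prod {n : ℕ} {f : Fin n → ℕ → ℚ⟦X⟧} (h : ∀ i m, X ^ m ∣ f i m) :
    ∑' a : Fin n → ℕ, ∏ i, f i (a i) = ∏ i, ∑' m, f i m := by
  induction n with
  | zero => simp
  | succ n ih =>
    have hf (a : Fin n → ℕ) : X ^ (∑ i, a i) ∣ ∏ i : Fin n, f i.succ (a i) := by
      rw [← Finset.prod_pow_eq_pow_sum]
      exact Finset.prod_dvd_prod_of_dvd _ _ fun i _ => h _ _
    rw [← (Fin.consEquiv fun _ : Fin (n + 1) => ℕ).tsum_eq, CoeffFinite.tsum_prod]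
    · simp only [Fin.consEquiv_apply, Fin.prod_univ_succ, Fin.cons_zero, Fin.cons_succ]
      rw [← ih fun i m => h i.succ m]
      rw [← (coeffFinite_nat (h 0)).summable.tsum_mul_right]
      exact tsum_congr fun m => (coeffFinite_pi hf).summable.tsum_mul_left _
    · refine coeffFinite_of_X_pow_dvd (fun p => p.1 + ∑ i, p.2 i) (fun d => ?_) fun p => ?_
      · refine ((Set.finite_Iic d).prod (finite_sum_le d)).subset fun p hp => ?_
        simp only [Set.mem_ofPred_eq, Set.mem_prod, Set.mem_Iic] at hp ⊢
        omega
      · simp only [Fin.consEquiv_apply, Fin.prod_univ_succ, Fin.cons_zero, Fin.cons_succ]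
        rw [pow_add]
        exact mul_dvd_mul (h _ _) (hf _)

theorem tendsto_of_X_pow_dvd_sub {f : ℕ → ℚ⟦X⟧} {g : ℚ⟦X⟧} (h : ∀ n, X ^ n ∣ f n - g) :
    Filter.Tendsto f Filter.atTop (nhds g) := by
  refine (WithPiTopology.tendsto_iff_coeff_tendsto _ _ _ _).mpr fun d => ?_
  refine tendsto_const_nhds.congr' (Filter.eventually_atTop.mpr ⟨d + 1, fun n hn => ?_⟩)
  have h1 := X_pow_dvd_iff.mp (h n) d hn
  rw [map_sub, sub_eq_zero] at h1
  exact h1.symm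

theorem X_pow_dvd_tsum {ι : Type*} {f : ι → ℚ⟦X⟧} {n : ℕ} (hf : Summable f)
    (h : ∀ i, X ^ n ∣ f i) : X ^ n ∣ ∑' i, f i := by
  choose g hg using h
  refine X_pow_dvd_iff.mpr fun d hd => ?_
  rw [← ((WithPiTopology.hasSum_iff_hasSum_coeff _).mp hf.hasSum d).tsum_eq]
  simp [hg, coeff_X_pow_mul', not_le.mpr hd]

/-! ### Pochhammer symbols -/

theorem one_sub_X_pow_ne_zero (n : ℕ) : (1 : ℚ⟦X⟧) - X ^ (n + 1) ≠ 0 := by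
  intro h
  simpa using congrArg (constantCoeff (R := ℚ)) h

theorem one_sub_X_pow_mul_inv (n : ℕ) :
    ((1 : ℚ⟦X⟧) - X ^ (n + 1)) * (1 - X ^ (n + 1))⁻¹ = 1 :=
  PowerSeries.mul_inv_cancel _ (by simp)

@[simp] theorem qPoch_zero : qPoch 0 = 1 := by simp [qPoch]

theorem qPoch_succ (n : ℕ) : qPoch (n + 1) = qPoch n * (1 - X ^ (n + 1)) :=
  Finset.prod_range_succ _ _

theorem constantCoeff_qPoch (n : ℕ) : constantCoeff (qPoch n) = 1 := by
  simp [qPoch, map_prod]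

theorem qPoch_ne_zero (n : ℕ) : qPoch n ≠ 0 := by
  intro h
  simpa [h] using constantCoeff_qPoch n

theorem qPoch_mul_inv (n : ℕ) : qPoch n * (qPoch n)⁻¹ = 1 :=
  PowerSeries.mul_inv_cancel _ (by simp [constantCoeff_qPoch])

theorem inv_qPoch_succ_mul (n : ℕ) : (qPoch (n + 1))⁻¹ * (1 - X ^ (n + 1)) = (qPoch n)⁻¹ := by
  rw [qPoch_succ, PowerSeries.mul_inv_rev, mul_right_comm, mul_comm _ (1 - _),
    one_sub_X_pow_mul_inv, one_mul]

theorem tsum_X_pow_mul (N : ℕ) :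
    ∑' b : ℕ, (X : ℚ⟦X⟧) ^ (b * (N + 1)) = (1 - X ^ (N + 1))⁻¹ := by
  have h := WithPiTopology.tsum_pow_mul_one_sub_of_constantCoeff_eq_zero
    (f := (X : ℚ⟦X⟧) ^ (N + 1)) (by simp)
  rw [PowerSeries.eq_inv_iff_mul_eq_one (by simp)]
  simpa only [← pow_mul, mul_comm (N + 1)] using h

theorem X_pow_dvd_mul_succ (b N : ℕ) (f : ℚ⟦X⟧) : X ^ b ∣ X ^ (b * (N + 1)) * f :=
  (pow_dvd_pow _ (Nat.le_mul_of_pos_right b N.succ_pos)).mul_right f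

/-- The series `∑ₐ q^{a (N + 1)} / (q)ₐ`, equal to `(q)_N / (q)_∞` by `eulerSum_eq_mul` and
`eulerSum_zero_mul_qPochInf`. -/
noncomputable def eulerSum (N : ℕ) : ℚ⟦X⟧ :=
  ∑' a : ℕ, X ^ (a * (N + 1)) * (qPoch a)⁻¹

theorem summable_eulerSum (N : ℕ) :
    Summable fun a : ℕ => X ^ (a * (N + 1)) * (qPoch a)⁻¹ :=
  (coeffFinite_nat fun a => X_pow_dvd_mul_succ a N _).summable

/-- The functional equation of Euler's series, from `(1 - qᵃ) / (q)ₐ = 1 / (q)_{a - 1}`. -/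
theorem eulerSum_succ (N : ℕ) : eulerSum (N + 1) = eulerSum N * (1 - X ^ (N + 1)) := by
  have h1 : eulerSum N - eulerSum (N + 1) = X ^ (N + 1) * eulerSum N := by
    rw [eulerSum, eulerSum, ← (summable_eulerSum N).tsum_sub (summable_eulerSum (N + 1)),
      ← (summable_eulerSum N).tsum_mul_left, Summable.tsum_eq_zero_add
        ((summable_eulerSum N).sub (summable_eulerSum (N + 1)))]
    simp only [zero_mul, pow_zero, sub_self, zero_add]
    refine tsum_congr fun a => ?_
    rw [← inv_qPoch_succ_mul a]
    ring
  linear_combination -h1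

theorem eulerSum_eq_mul (N : ℕ) : eulerSum N = eulerSum 0 * qPoch N := by
  induction N with
  | zero => simp
  | succ N ih => rw [eulerSum_succ, ih, qPoch_succ]; ring

/-- Euler's identity `∑ₐ qᵃ / (q)ₐ = 1 / (q)_∞`. -/
theorem eulerSum_zero_mul_qPochInf : eulerSum 0 * qPochInf = 1 := by
  have h1 : Filter.Tendsto eulerSum Filter.atTop (nhds 1) := by
    -- only the term `a = 0` survives as `N` grows
    refine tendsto_of_X_pow_dvd_sub fun N => ?_
    have hs := summable_eulerSum N
    rw [eulerSum, hs.tsum_eq_zero_add]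
    simp only [zero_mul, pow_zero, qPoch_zero, one_mul, inv_one, add_sub_cancel_left]
    refine X_pow_dvd_tsum ((summable_nat_add_iff 1).mpr hs) fun a => ?_
    exact (pow_dvd_pow _ (by nlinarith)).mul_right _
  have h2 : Filter.Tendsto eulerSum Filter.atTop (nhds (eulerSum 0 * qPochInf)) := by
    exact (multipliable_qPochInf.hasProd.tendsto_prod_nat.const_mul (eulerSum 0)).congr
      fun N => (eulerSum_eq_mul N).symm
  exact tendsto_nhds_unique h2 h1

theorem qPochInf_ne_zero : qPochInf ≠ 0 :=
  right_ne_zero_of_mul_eq_one eulerSum_zero_mul_qPochInf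

/-- The series `∑_b (q)_{b + c} / (q)_b q^{b (N + 1)}`, evaluated in `binomialSum_mul`. -/
noncomputable def binomialSum (c N : ℕ) : ℚ⟦X⟧ :=
  ∑' b : ℕ, X ^ (b * (N + 1)) * (qPoch b)⁻¹ * qPoch (b + c)

theorem summable_binomialSum (c N : ℕ) :
    Summable fun b : ℕ => X ^ (b * (N + 1)) * (qPoch b)⁻¹ * qPoch (b + c) :=
  (coeffFinite_nat fun b => (X_pow_dvd_mul_succ b N _).mul_right _).summable

theorem binomialSum_zero (N : ℕ) : binomialSum 0 N = (1 - X ^ (N + 1))⁻¹ := by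
  rw [← tsum_X_pow_mul]
  refine tsum_congr fun b => ?_
  rw [add_zero, mul_assoc, mul_comm _⁻¹, qPoch_mul_inv, mul_one]

theorem binomialSum_succ (c N : ℕ) :
    binomialSum (c + 1) N = binomialSum c N - X ^ (c + 1) * binomialSum c (N + 1) := by
  rw [binomialSum, binomialSum, binomialSum, ← (summable_binomialSum c (N + 1)).tsum_mul_left,
    ← (summable_binomialSum c N).tsum_sub ((summable_binomialSum c (N + 1)).mul_left _)]
  refine tsum_congr fun b => ?_
  rw [← add_assoc, qPoch_succ]
  ring

/-- The `q`-binomial theorem `∑_b [b + c, b] z^b = 1 / ((1 - z)(1 - z q) ⋯ (1 - z q^c))` at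
`z = q^{N + 1}`. -/
theorem binomialSum_mul (c N : ℕ) :
    binomialSum c N * qPoch (N + c + 1) = qPoch c * qPoch N := by
  induction c generalizing N with
  | zero =>
    rw [binomialSum_zero, add_zero, qPoch_succ, qPoch_zero]
    linear_combination qPoch N * one_sub_X_pow_mul_inv N
  | succ c ih =>
    have h1 := ih N
    have h2 := ih (N + 1)
    rw [binomialSum_succ, ← add_assoc, qPoch_succ (N + c + 1), qPoch_succ c]
    rw [show N + 1 + c + 1 = N + c + 1 + 1 by ring, qPoch_succ (N + c + 1), qPoch_succ N] at h2
    linear_combination (1 - X ^ (N + c + 1 + 1)) * h1 - X ^ (c + 1) * h2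

/-! ### Sums over chains -/

/-- The polynomials `Q_n(e)` in which sums over chains are expanded, see
`chainSum_eq_chainExpansion`. The recursion reads
`(1 - q^{e + 1}) (Q_n(e) - Q_n(e + 1)) = Q_n(e) - Q_{n + 1}(e)`, so that dividing by `1 - q^{e + 1}`
and summing over `e` amounts to partial summation of coefficients over `n`. -/
noncomputable def chainPoly : ℕ → ℕ → ℚ⟦X⟧
  | 0, e => X ^ e
  | n + 1, e => X ^ (e + 1) * chainPoly n e + (1 - X ^ (e + 1)) * chainPoly n (e + 1)

theorem X_pow_dvd_chainPoly (n e : ℕ) : X ^ (n + e) ∣ chainPoly n e := by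
  induction n generalizing e with
  | zero => simp [chainPoly]
  | succ n ih =>
    refine dvd_add ?_ (Dvd.dvd.mul_left ?_ _)
    · exact (pow_dvd_pow _ (by omega)).trans
        ((pow_add (X : ℚ⟦X⟧) (e + 1) (n + e)).dvd.trans (mul_dvd_mul_left _ (ih e)))
    · exact (pow_dvd_pow _ (by omega)).trans (ih (e + 1))

/-- The moment `∑ₑ q^{e j} Q_n(e)`. -/
noncomputable def chainMoment (n j : ℕ) : ℚ⟦X⟧ :=
  ∑' e : ℕ, X ^ (e * j) * chainPoly n e

theorem summable_chainMoment (n j : ℕ) : Summable fun e : ℕ => X ^ (e * j) * chainPoly n e :=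
  (coeffFinite_nat fun e => ((pow_dvd_pow _ (Nat.le_add_left e n)).trans
    (X_pow_dvd_chainPoly n e)).mul_left _).summable

theorem chainMoment_zero (j : ℕ) : chainMoment 0 j = (1 - X ^ (j + 1))⁻¹ := by
  rw [← tsum_X_pow_mul]
  refine tsum_congr fun e => ?_
  rw [chainPoly, ← pow_add, Nat.mul_succ]

/-- The recursion for `chainMoment` that the definition of `chainPoly` entails. In the sum of
`q^{e j} (1 - q^{e + 1}) Q_n(e + 1)` the shift of `e` by one loses no term, as `1 - q^e` vanishes at
`e = 0`. -/
theorem X_pow_mul_chainMoment_succ (n j : ℕ) :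
    X ^ j * chainMoment (n + 1) j =
      X ^ (j + 1) * chainMoment n (j + 1) + (chainMoment n j - chainMoment n (j + 1)) := by
  have h0 := summable_chainMoment n j
  have h1 := summable_chainMoment n (j + 1)
  have h2 : chainMoment n j - chainMoment n (j + 1) =
      ∑' e : ℕ, (X ^ ((e + 1) * j) * chainPoly n (e + 1) -
        X ^ ((e + 1) * (j + 1)) * chainPoly n (e + 1)) := by
    rw [chainMoment, chainMoment, ← h0.tsum_sub h1, (h0.sub h1).tsum_eq_zero_add]
    simp
  rw [h2, chainMoment, chainMoment, ← (summable_chainMoment (n + 1) j).tsum_mul_left,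
    ← h1.tsum_mul_left, ← (h1.mul_left _).tsum_add ((summable_nat_add_iff 1).mpr (h0.sub h1))]
  refine tsum_congr fun e => ?_
  rw [chainPoly]
  ring

/-- The sum `∑_{m ≤ n} (q)_{m + j} / (q)_m`. -/
noncomputable def pochRatioSum (n j : ℕ) : ℚ⟦X⟧ :=
  ∑ m ∈ Finset.range (n + 1), (qPoch m)⁻¹ * qPoch (m + j)

theorem pochRatioSum_succ_right (n j : ℕ) :
    pochRatioSum n (j + 1) = pochRatioSum n j -
      X ^ (j + 1) * ∑ m ∈ Finset.range (n + 1), X ^ m * ((qPoch m)⁻¹ * qPoch (m + j)) := by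
  rw [pochRatioSum, pochRatioSum, Finset.mul_sum, ← Finset.sum_sub_distrib]
  refine Finset.sum_congr rfl fun m _ => ?_
  rw [← add_assoc, qPoch_succ]
  ring

/-- Telescoping: with `t_m = (q)_{m + j} / (q)_m`,
`(1 - q^{m + 1}) t_{m + 1} - (1 - q^m) t_m = (1 - q^{j + 1}) q^m t_m`. -/
theorem one_sub_mul_sum_X_pow_mul_pochRatio (n j : ℕ) :
    (1 - X ^ (j + 1)) * ∑ m ∈ Finset.range (n + 1), X ^ m * ((qPoch m)⁻¹ * qPoch (m + j)) =
      (1 - X ^ (n + 1)) * ((qPoch (n + 1))⁻¹ * qPoch (n + 1 + j)) := by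
  have h (m : ℕ) : (1 - X ^ (m + 1)) * ((qPoch (m + 1))⁻¹ * qPoch (m + 1 + j)) =
      (qPoch m)⁻¹ * qPoch (m + j) * (1 - X ^ (m + j + 1)) := by
    rw [show m + 1 + j = m + j + 1 by ring, qPoch_succ (m + j), ← inv_qPoch_succ_mul m]
    ring
  induction n with
  | zero => rw [h]; simp [mul_comm]
  | succ n ih =>
    rw [Finset.sum_range_succ, mul_add, ih, h (n + 1)]
    ring

/-- Closed form of the moments. Only `j = 0` is used later, but the recursion in `n` raises `j`. -/
theorem qPoch_mul_chainMoment (n j : ℕ) :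
    qPoch (j + n + 1) * chainMoment n j = X ^ n * qPoch n * pochRatioSum n j := by
  induction n generalizing j with
  | zero =>
    rw [chainMoment_zero, add_zero, qPoch_succ]
    simp only [pochRatioSum, zero_add, Finset.range_one, Finset.sum_singleton, qPoch_zero, inv_one,
      pow_zero, one_mul]
    linear_combination qPoch j * one_sub_X_pow_mul_inv j
  | succ n ih =>
    have h0 := ih j
    have h1 := ih (j + 1)
    have hT : pochRatioSum (n + 1) j =
        pochRatioSum n j + (qPoch (n + 1))⁻¹ * qPoch (n + 1 + j) := Finset.sum_range_succ _ _
    have hU := one_sub_mul_sum_X_pow_mul_pochRatio n j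
    have hm := X_pow_mul_chainMoment_succ n j
    rw [pochRatioSum_succ_right] at h1
    rw [show j + 1 + n + 1 = j + n + 1 + 1 by ring, qPoch_succ (j + n + 1)] at h1
    rw [← add_assoc, qPoch_succ (j + n + 1), hT]
    generalize (qPoch (n + 1))⁻¹ * qPoch (n + 1 + j) = u at hU ⊢
    rw [qPoch_succ n]
    refine mul_left_cancel₀ (pow_ne_zero j X_ne_zero) ?_
    linear_combination (qPoch (j + n + 1) * (1 - X ^ (j + n + 1 + 1))) * hm +
      (X ^ (j + 1) - 1) * h1 + (1 - X ^ (j + n + 1 + 1)) * h0 +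
      X ^ (j + n + 1) * qPoch n * hU

theorem tsum_chainPoly (n : ℕ) :
    ∑' e, chainPoly n e = C ((n + 1 : ℕ) : ℚ) * X ^ n * (1 - X ^ (n + 1))⁻¹ := by
  have h := qPoch_mul_chainMoment n 0
  have h1 : pochRatioSum n 0 = ((n + 1 : ℕ) : ℚ⟦X⟧) := by
    simp [pochRatioSum, mul_comm _⁻¹, qPoch_mul_inv]
  have h2 : chainMoment n 0 = ∑' e, chainPoly n e := by simp [chainMoment]
  rw [zero_add, qPoch_succ, h1, h2] at h
  rw [map_natCast]
  refine mul_left_cancel₀ (mul_ne_zero (qPoch_ne_zero n) (one_sub_X_pow_ne_zero n)) ?_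
  linear_combination h - qPoch n * X ^ n * ((n + 1 : ℕ) : ℚ⟦X⟧) * one_sub_X_pow_mul_inv n

/-- The expansion `∑ₙ ((k, n)) Q_n(e)`, where `((k, n))` counts multisets of size `n` of a set of
size `k`. -/
noncomputable def chainExpansion (k e : ℕ) : ℚ⟦X⟧ :=
  ∑' n : ℕ, C (k.multichoose n : ℚ) * chainPoly n e

theorem coeffFinite_mul_chainPoly (c : ℕ → ℚ⟦X⟧) :
    CoeffFinite (Function.uncurry fun e n => c n * chainPoly n e) :=
  coeffFinite_nat_prod fun e n => by
    rw [add_comm]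
    exact (X_pow_dvd_chainPoly n e).mul_left _

theorem summable_mul_chainPoly (c : ℕ → ℚ⟦X⟧) (e : ℕ) :
    Summable fun n => c n * chainPoly n e :=
  ((coeffFinite_mul_chainPoly c).comp_injective (Prod.mk_right_injective e)).summable

theorem X_pow_dvd_chainExpansion (k e : ℕ) : X ^ e ∣ chainExpansion k e :=
  X_pow_dvd_tsum (summable_mul_chainPoly _ e) fun n => ((pow_dvd_pow _ (Nat.le_add_left e n)).trans
    (X_pow_dvd_chainPoly n e)).mul_left _

theorem chainExpansion_zero (e : ℕ) : chainExpansion 0 e = X ^ e := by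
  rw [chainExpansion, tsum_eq_single 0]
  · simp [chainPoly]
  · intro n hn
    obtain ⟨m, rfl⟩ := Nat.exists_eq_succ_of_ne_zero hn
    simp

theorem one_sub_mul_chainExpansion_sub (k e : ℕ) :
    (1 - X ^ (e + 1)) * (chainExpansion (k + 1) e - chainExpansion (k + 1) (e + 1)) =
      chainExpansion k e := by
  have h0 := summable_mul_chainPoly (fun n => C ((k + 1).multichoose n : ℚ)) e
  have h1 := summable_mul_chainPoly (fun n => C ((k + 1).multichoose n : ℚ)) (e + 1)
  have h2 := summable_mul_chainPoly (fun n => C (k.multichoose n : ℚ)) e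
  have h3 : Summable fun n => C ((k + 1).multichoose n : ℚ) * chainPoly (n + 1) e :=
    (coeffFinite_nat fun n => ((pow_dvd_pow _ (by omega)).trans
      (X_pow_dvd_chainPoly (n + 1) e)).mul_left _).summable
  have h4 : (1 - X ^ (e + 1)) * (chainExpansion (k + 1) e - chainExpansion (k + 1) (e + 1)) =
      chainExpansion (k + 1) e - ∑' n, C ((k + 1).multichoose n : ℚ) * chainPoly (n + 1) e := by
    rw [chainExpansion, chainExpansion, ← h0.tsum_sub h1, ← (h0.sub h1).tsum_mul_left,
      ← h0.tsum_sub h3]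
    refine tsum_congr fun n => ?_
    rw [chainPoly]
    ring
  rw [h4, chainExpansion, chainExpansion, h0.tsum_eq_zero_add, h2.tsum_eq_zero_add, add_sub_assoc,
    ← ((summable_nat_add_iff 1).mpr h0).tsum_sub h3]
  simp only [Nat.multichoose_zero_right]
  congr 1
  refine tsum_congr fun n => ?_
  rw [Nat.multichoose_succ_succ]
  push_cast
  rw [map_add]
  ring

/-- `chainExpansion` satisfies the recursion of `chainSum_succ`. -/
theorem chainExpansion_succ (k e : ℕ) :
    chainExpansion (k + 1) e =
      ∑' j : ℕ, chainExpansion k (e + j) * (1 - X ^ (e + j + 1))⁻¹ := by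
  have hs : Summable fun j : ℕ => chainExpansion k (e + j) * (1 - X ^ (e + j + 1))⁻¹ :=
    (coeffFinite_nat fun j => ((pow_dvd_pow _ (Nat.le_add_left j e)).trans
      (X_pow_dvd_chainExpansion k (e + j))).mul_right _).summable
  have h (j : ℕ) : chainExpansion k (e + j) * (1 - X ^ (e + j + 1))⁻¹ =
      chainExpansion (k + 1) (e + j) - chainExpansion (k + 1) (e + (j + 1)) := by
    rw [← one_sub_mul_chainExpansion_sub, mul_comm, ← mul_assoc, mul_comm _⁻¹,
      one_sub_X_pow_mul_inv, one_mul, add_assoc e j 1]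
  refine tendsto_nhds_unique (tendsto_of_X_pow_dvd_sub fun J => ?_) hs.hasSum.tendsto_sum_nat
  simp only [h]
  rw [Finset.sum_range_sub' (fun j => chainExpansion (k + 1) (e + j)), add_zero, sub_sub_cancel_left,
    dvd_neg]
  exact (pow_dvd_pow _ (Nat.le_add_left J e)).trans (X_pow_dvd_chainExpansion _ _)

/-- The tail `c_s + c_{s + 1} + ⋯` of a tuple; it vanishes for `s` beyond the length. -/
def tailSum {k : ℕ} (c : Fin k → ℕ) (s : ℕ) : ℕ :=
  ∑ t : Fin k, if s ≤ t then c t else 0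

theorem tailSum_zero {k : ℕ} (c : Fin k → ℕ) : tailSum c 0 = ∑ t, c t := by
  simp [tailSum]

theorem tailSum_snoc {k : ℕ} (c : Fin k → ℕ) (j s : ℕ) :
    tailSum (Fin.snoc (α := fun _ => ℕ) c j) s = tailSum c s + if s ≤ k then j else 0 := by
  simp [tailSum, Fin.sum_univ_castSucc]

theorem tailSum_last {k : ℕ} (c : Fin (k + 1) → ℕ) : tailSum c k = c (Fin.last k) := by
  rw [tailSum, Finset.sum_eq_single (Fin.last k)]
  · simp
  · intro t _ ht
    rw [if_neg]
    intro h
    exact ht (Fin.ext (le_antisymm (Fin.le_last t) h))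
  · simp

theorem tailSum_castSucc {k : ℕ} (c : Fin (k + 1) → ℕ) (s : Fin k) :
    tailSum c s = c s.castSucc + tailSum c (s + 1) := by
  rw [tailSum, tailSum, ← Finset.add_sum_erase _ _ (Finset.mem_univ s.castSucc),
    ← Finset.add_sum_erase _ _ (Finset.mem_univ s.castSucc)]
  simp only [Fin.val_castSucc, le_refl, if_true, Nat.succ_le_iff, lt_irrefl, if_false, zero_add]
  congr 1
  refine Finset.sum_congr rfl fun t ht => ?_
  have h : (t : ℕ) ≠ s := fun h => (Finset.mem_erase.mp ht).1 (Fin.ext h)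
  exact if_congr (by omega) rfl rfl

/-- The term at `c` of `chainSum`. -/
noncomputable def chainTerm (k e : ℕ) (c : Fin k → ℕ) : ℚ⟦X⟧ :=
  X ^ (e + tailSum c 0) * ∏ s : Fin k, (1 - X ^ (e + tailSum c s + 1))⁻¹

/-- The sum `∑ q^{C_0} / ((1 - q^{C_0 + 1}) ⋯ (1 - q^{C_{k - 1} + 1}))` over all chains
`C_0 ≥ C_1 ≥ ⋯ ≥ C_{k - 1} ≥ e`, where a chain is encoded by its successive differences
`c_s = C_s - C_{s + 1}`, with `C_k = e`. -/
noncomputable def chainSum (k e : ℕ) : ℚ⟦X⟧ :=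
  ∑' c : Fin k → ℕ, chainTerm k e c

theorem X_pow_dvd_chainTerm (k e : ℕ) (c : Fin k → ℕ) : X ^ (e + ∑ t, c t) ∣ chainTerm k e c := by
  rw [chainTerm, tailSum_zero]
  exact dvd_mul_right _ _

/-- Summation over tuples, split according to the last entry. -/
theorem tsum_snoc {k : ℕ} {f : (Fin (k + 1) → ℕ) → ℚ⟦X⟧} (h : ∀ c, X ^ (∑ t, c t) ∣ f c) :
    ∑' c, f c = ∑' j : ℕ, ∑' c : Fin k → ℕ, f (Fin.snoc (α := fun _ => ℕ) c j) := by
  rw [← (Fin.snocEquiv fun _ : Fin (k + 1) => ℕ).tsum_eq, CoeffFinite.tsum_prod]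
  · rfl
  · exact (coeffFinite_pi h).comp_injective (Equiv.injective _)

theorem chainSum_succ (k e : ℕ) :
    chainSum (k + 1) e = ∑' j : ℕ, chainSum k (e + j) * (1 - X ^ (e + j + 1))⁻¹ := by
  rw [chainSum, tsum_snoc fun c => (pow_dvd_pow _ (Nat.le_add_left _ e)).trans
    (X_pow_dvd_chainTerm (k + 1) e c)]
  refine tsum_congr fun j => ?_
  rw [chainSum, ← (coeffFinite_pi fun c => (pow_dvd_pow _ (Nat.le_add_left _ (e + j))).trans
    (X_pow_dvd_chainTerm k (e + j) c)).summable.tsum_mul_right]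
  refine tsum_congr fun c => ?_
  have h : tailSum c k = 0 := by
    simp only [tailSum]
    exact Finset.sum_eq_zero fun t _ => if_neg (not_le.mpr t.isLt)
  simp only [chainTerm, tailSum_snoc, Fin.prod_univ_castSucc, Fin.val_castSucc, Fin.is_le',
    if_true, Nat.zero_le, Fin.val_last, le_refl, h, zero_add, ← mul_assoc]
  congr 2
  · congr 1
    omega
  · refine Finset.prod_congr rfl fun s _ => ?_
    congr 3
    omega

theorem chainSum_eq_chainExpansion (k e : ℕ) : chainSum k e = chainExpansion k e := by
  induction k generalizing e with
  | zero => rw [chainExpansion_zero]; simp [chainSum, chainTerm, tailSum]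
  | succ k ih =>
    rw [chainSum_succ, chainExpansion_succ]
    exact tsum_congr fun j => by rw [ih]

theorem multichoose_eq_choose {k : ℕ} (hk : 1 ≤ k) (n : ℕ) :
    k.multichoose n = (n + k - 1).choose (k - 1) := by
  rw [Nat.multichoose_eq, ← Nat.choose_symm (by omega)]
  congr 1 <;> omega

/-- The sum over all chains is the numerator of the first identity, up to a shift. -/
theorem X_mul_tsum_chainSum {k : ℕ} (hk : 1 ≤ k) :
    X * ∑' e, chainSum k e = macMahonNumerator k := by
  simp only [chainSum_eq_chainExpansion, chainExpansion]
  rw [(coeffFinite_mul_chainPoly fun n => C (k.multichoose n : ℚ)).tsum_comm]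
  have h (n : ℕ) : ∑' e, C (k.multichoose n : ℚ) * chainPoly n e =
      X ^ n * (C (((n + 1) * (n + k - 1).choose (k - 1) : ℕ) : ℚ) * (1 - X ^ (n + 1))⁻¹) := by
    have hs : Summable fun e => chainPoly n e := by simpa using summable_chainMoment n 0
    rw [hs.tsum_mul_left, tsum_chainPoly, multichoose_eq_choose hk, Nat.cast_mul, map_mul]
    ring
  simp only [h]
  rw [macMahonNumerator, ← (coeffFinite_nat fun n => dvd_mul_right _ _).summable.tsum_mul_left]
  refine tsum_congr fun n => ?_
  rw [macMahonNumeratorTerm]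
  ring

/-! ### Graph series of a relabelled graph -/

/-- If the relabelled adjacency matrix is `W + Wᵀ`, then `½ n A nᵀ = n W nᵀ`. -/
theorem quadForm_eq {V V' : Type*} [Fintype V] [Fintype V'] (G : SimpleGraph V) (f : V' ≃ V)
    (W : V' → V' → ℕ) (h : ∀ x y, W x y + W y x = 1 ∧ G.Adj (f x) (f y) ∨
      W x y + W y x = 0 ∧ ¬ G.Adj (f x) (f y)) (n : V → ℕ) :
    quadForm G n = ∑ x, ∑ y, W x y * (n (f x) * n (f y)) := by
  classical
  have h1 : 2 * quadForm G n = ∑ x, ∑ y, (W x y + W y x) * (n (f x) * n (f y)) := by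
    rw [two_mul_quadForm]
    simp only [dotProduct, Matrix.mulVec, Finset.mul_sum, SimpleGraph.adjMatrix_apply]
    rw [← f.sum_comp]
    refine Finset.sum_congr rfl fun x _ => ?_
    rw [← f.sum_comp]
    refine Finset.sum_congr rfl fun y _ => ?_
    rcases h x y with ⟨hw, ha⟩ | ⟨hw, ha⟩
    · simp [hw, ha]
    · simp [hw, ha]
  have h2 : ∑ x, ∑ y, W y x * (n (f x) * n (f y)) = ∑ x, ∑ y, W x y * (n (f x) * n (f y)) := by
    rw [Finset.sum_comm]
    simp only [mul_comm]
  simp only [add_mul, Finset.sum_add_distrib, h2] at h1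
  omega

theorem prod_inv {ι : Type*} (s : Finset ι) (f : ι → ℚ⟦X⟧) :
    (∏ i ∈ s, f i)⁻¹ = ∏ i ∈ s, (f i)⁻¹ := by
  classical
  induction s using Finset.induction_on with
  | empty => simp
  | insert i s hi ih =>
    rw [Finset.prod_insert hi, Finset.prod_insert hi, PowerSeries.mul_inv_rev, ih, mul_comm]

theorem graphSeries_eq {V V' : Type*} [Fintype V] [Fintype V'] (G : SimpleGraph V) (f : V' ≃ V)
    (W : V' → V' → ℕ) (h : ∀ x y, W x y + W y x = 1 ∧ G.Adj (f x) (f y) ∨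
      W x y + W y x = 0 ∧ ¬ G.Adj (f x) (f y)) :
    graphSeries G = ∑' n : V' → ℕ,
      X ^ (∑ x, ∑ y, W x y * (n x * n y) + ∑ x, n x) * ∏ x, (qPoch (n x))⁻¹ := by
  rw [graphSeries, ← (f.arrowCongr (Equiv.refl ℕ)).tsum_eq]
  refine tsum_congr fun n => ?_
  rw [graphSeriesTerm, quadForm_eq G f W h, ← f.sum_comp, ← f.prod_comp, prod_inv]
  simp

theorem tsum_sumArrow {V W : Type*} [Fintype V] [Fintype W] {f : (V ⊕ W → ℕ) → ℚ⟦X⟧}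
    (h : ∀ n, X ^ (∑ x, n x) ∣ f n) :
    ∑' n, f n = ∑' u : V → ℕ, ∑' v : W → ℕ, f (Sum.elim u v) := by
  rw [← (Equiv.sumArrowEquivProdArrow V W ℕ).symm.tsum_eq, CoeffFinite.tsum_prod]
  · rfl
  · exact (coeffFinite_pi h).comp_injective (Equiv.injective _)

/-! ### The leafless graph -/

/-- Labels of the vertices of `leafless k` by three families, of residues `1`, `0` and `2` modulo
three. -/
def leaflessLabel (k : ℕ) : Fin (k + 1) ⊕ Fin (k + 1) ⊕ Fin k → Fin (3 * k + 2)
  | .inl t => ⟨3 * t + 1, by omega⟩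
  | .inr (.inl s) => ⟨3 * s, by omega⟩
  | .inr (.inr s) => ⟨3 * s + 2, by omega⟩

theorem leaflessLabel_bijective (k : ℕ) : Function.Bijective (leaflessLabel k) := by
  refine (Fintype.bijective_iff_injective_and_card _).mpr ⟨?_, by simp; omega⟩
  rintro (x | x | x) (y | y | y) h <;>
    simp only [leaflessLabel, Sum.inl.injEq, Sum.inr.injEq, reduceCtorEq,
      Fin.ext_iff] at h ⊢ <;> omega

/-- Half of the adjacency matrix of `leafless k`. Writing `c`, `b`, `a` for the three families, the
edges are `b_s ∼ c_t` for `s ≤ t`, `a_s ∼ c_s`, and `a_s ∼ b_{s + 1}`. -/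
def leaflessWeight (k : ℕ) :
    Fin (k + 1) ⊕ Fin (k + 1) ⊕ Fin k → Fin (k + 1) ⊕ Fin (k + 1) ⊕ Fin k → ℕ
  | .inr (.inl s), .inl t => if (s : ℕ) ≤ t then 1 else 0
  | .inr (.inr s), .inl t => if s.castSucc = t then 1 else 0
  | .inr (.inr s), .inr (.inl t) => if s.succ = t then 1 else 0
  | _, _ => 0

theorem leafless_adj_of_le {k : ℕ} (s t : Fin (k + 1)) (h : (s : ℕ) ≤ t) :
    (leafless k).Adj (leaflessLabel k (.inr (.inl s))) (leaflessLabel k (.inl t)) := by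
  simp only [leafless, SimpleGraph.fromRel_adj, leaflessLabel, ne_eq, Fin.mk.injEq, Finset.mem_Icc,
    Finset.mem_range]
  refine ⟨by omega, ?_⟩
  by_cases h1 : (t : ℕ) = s
  · omega
  by_cases h2 : (s : ℕ) ≤ 1
  · by_cases h3 : (t : ℕ) = 1
    · omega
    · exact .inl (.inr (.inr (.inr (.inl ⟨t, by omega, by omega, by omega⟩))))
  · exact .inl (.inr (.inr (.inr (.inr ⟨t - 1, by omega, s, by omega, by omega, by omega⟩))))

theorem leafless_adj_castSucc {k : ℕ} (s : Fin k) :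
    (leafless k).Adj (leaflessLabel k (.inr (.inr s))) (leaflessLabel k (.inl s.castSucc)) := by
  simp only [leafless, SimpleGraph.fromRel_adj, leaflessLabel, ne_eq, Fin.mk.injEq, Finset.mem_Icc,
    Finset.mem_range, Fin.val_castSucc, and_true]
  omega

theorem leafless_adj_succ {k : ℕ} (s : Fin k) :
    (leafless k).Adj (leaflessLabel k (.inr (.inr s))) (leaflessLabel k (.inr (.inl s.succ))) := by
  simp only [leafless, SimpleGraph.fromRel_adj, leaflessLabel, ne_eq, Fin.mk.injEq, Finset.mem_Icc,
    Finset.mem_range, Fin.val_succ]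
  omega

theorem leaflessWeight_spec (k : ℕ) (x y) :
    leaflessWeight k x y + leaflessWeight k y x = 1 ∧
      (leafless k).Adj (leaflessLabel k x) (leaflessLabel k y) ∨
    leaflessWeight k x y + leaflessWeight k y x = 0 ∧
      ¬ (leafless k).Adj (leaflessLabel k x) (leaflessLabel k y) := by
  have key : ∀ x y, (leafless k).Adj (leaflessLabel k x) (leaflessLabel k y) →
      leaflessWeight k x y + leaflessWeight k y x = 1 := by
    intro x y hxy
    simp only [leafless, SimpleGraph.fromRel_adj, ne_eq, Finset.mem_Icc, Finset.mem_range] at hxy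
    obtain ⟨hne, h⟩ := hxy
    rcases x with x | x | x <;> rcases y with y | y | y <;>
      simp only [leaflessLabel, leaflessWeight, Fin.ext_iff, Fin.val_castSucc,
        Fin.val_succ, add_zero, zero_add] at hne h ⊢ <;>
      rcases h with (h | h | h | ⟨t, ht, h⟩ | ⟨l, hl, s, hs, h⟩) |
        (h | h | h | ⟨t, ht, h⟩ | ⟨l, hl, s, hs, h⟩) <;>
      first | omega | (rw [if_pos]; omega)
  by_cases h : (leafless k).Adj (leaflessLabel k x) (leaflessLabel k y)
  · exact .inl ⟨key x y h, h⟩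
  · refine .inr ⟨?_, h⟩
    have h' := fun h' => h (SimpleGraph.Adj.symm h')
    rcases x with x | x | x <;> rcases y with y | y | y <;>
      simp only [leaflessWeight, add_zero, zero_add] <;> refine if_neg ?_
    · exact fun e => h' (leafless_adj_of_le _ _ e)
    · rintro rfl; exact h' (leafless_adj_castSucc _)
    · exact fun e => h (leafless_adj_of_le _ _ e)
    · rintro rfl; exact h' (leafless_adj_succ _)
    · rintro rfl; exact h (leafless_adj_castSucc _)
    · rintro rfl; exact h (leafless_adj_succ _)

theorem prod_X_pow_mul {n : ℕ} (u : Fin n → ℕ) (g : Fin n → ℚ⟦X⟧) :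
    ∏ i, X ^ u i * g i = X ^ (∑ i, u i) * ∏ i, g i := by
  rw [Finset.prod_mul_distrib, Finset.prod_pow_eq_pow_sum]

/-- The summand of the graph series of `leafless k`, with the powers of `q` distributed over the
factors. -/
theorem leaflessSummand_eq {k : ℕ} (c b : Fin (k + 1) → ℕ) (a : Fin k → ℕ) :
    (X : ℚ⟦X⟧) ^ (∑ x, ∑ y, leaflessWeight k x y *
        (Sum.elim c (Sum.elim b a) x * Sum.elim c (Sum.elim b a) y) +
        ∑ x, Sum.elim c (Sum.elim b a) x) *
      ∏ x, (qPoch (Sum.elim c (Sum.elim b a) x))⁻¹ =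
    (X ^ tailSum c 0 * ∏ t, (qPoch (c t))⁻¹) *
      ((∏ s, X ^ (b s * (tailSum c s + 1)) * (qPoch (b s))⁻¹) *
        ∏ s, X ^ (a s * (b s.succ + c s.castSucc + 1)) * (qPoch (a s))⁻¹) := by
  have h : ∑ x, ∑ y, leaflessWeight k x y *
        (Sum.elim c (Sum.elim b a) x * Sum.elim c (Sum.elim b a) y) +
        ∑ x, Sum.elim c (Sum.elim b a) x =
      tailSum c 0 + (∑ s : Fin (k + 1), b s * (tailSum c s + 1) +
        ∑ s : Fin k, a s * (b s.succ + c s.castSucc + 1)) := by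
    simp only [Fintype.sum_sum_type, Sum.elim_inl, Sum.elim_inr, leaflessWeight, Nat.zero_le,
      zero_mul, Finset.sum_const_zero, zero_add, add_zero, ite_mul, one_mul, Finset.sum_ite_eq,
      Finset.mem_univ, if_true, mul_add, mul_one, Finset.sum_add_distrib, tailSum, Finset.mul_sum,
      mul_ite, mul_zero]
    ring
  rw [h, prod_X_pow_mul, prod_X_pow_mul]
  simp only [Fintype.prod_sum_type, Sum.elim_inl, Sum.elim_inr]
  ring

theorem tsum_eulerSum_mul (c N : ℕ) :
    ∑' b : ℕ, X ^ (b * (N + 1)) * (qPoch b)⁻¹ * eulerSum (b + c) =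
      eulerSum 0 * binomialSum c N := by
  rw [binomialSum, ← (summable_binomialSum c N).tsum_mul_left]
  refine tsum_congr fun b => ?_
  rw [eulerSum_eq_mul (b + c)]
  ring

theorem X_pow_sum_dvd_prod {n : ℕ} (a u : Fin n → ℕ) (g : Fin n → ℚ⟦X⟧) :
    X ^ (∑ i, a i) ∣ ∏ i, X ^ (a i * (u i + 1)) * g i := by
  rw [← Finset.prod_pow_eq_pow_sum]
  exact Finset.prod_dvd_prod_of_dvd _ _ fun i _ => X_pow_dvd_mul_succ _ _ _

/-- The sum over `a` for fixed `b` and `c`, then over `b`: only the chain determined by `c` is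
left. -/
theorem tsum_tsum_leafless {k : ℕ} (c : Fin (k + 1) → ℕ) :
    ∑' b : Fin (k + 1) → ℕ, ∑' a : Fin k → ℕ,
      (∏ s, X ^ (b s * (tailSum c s + 1)) * (qPoch (b s))⁻¹) *
        ∏ s, X ^ (a s * (b s.succ + c s.castSucc + 1)) * (qPoch (a s))⁻¹ =
    eulerSum (tailSum c 0) *
      ∏ s : Fin k, eulerSum 0 * binomialSum (c s.castSucc) (tailSum c (s + 1)) := by
  -- the factors of the sum over `b`, where `b_{s + 1}` is coupled to `c_s` through `a_s`
  let g : Fin (k + 1) → ℕ → ℚ⟦X⟧ := Fin.cons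
    (fun b => X ^ (b * (tailSum c 0 + 1)) * (qPoch b)⁻¹)
    (fun s b => X ^ (b * (tailSum c (s + 1) + 1)) * (qPoch b)⁻¹ * eulerSum (b + c s.castSucc))
  have hg (s) (b) : X ^ b ∣ g s b := by
    refine Fin.cases ?_ (fun s => ?_) s
    · exact X_pow_dvd_mul_succ _ _ _
    · exact (X_pow_dvd_mul_succ _ _ _).mul_right _
  have h (b : Fin (k + 1) → ℕ) : ∑' a : Fin k → ℕ,
      (∏ s, X ^ (b s * (tailSum c s + 1)) * (qPoch (b s))⁻¹) *
        ∏ s, X ^ (a s * (b s.succ + c s.castSucc + 1)) * (qPoch (a s))⁻¹ = ∏ s, g s (b s) := by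
    rw [(coeffFinite_pi fun a => X_pow_sum_dvd_prod a _ _).summable.tsum_mul_left,
      tsum_pi_prod (f := fun s a => X ^ (a * (b s.succ + c s.castSucc + 1)) * (qPoch a)⁻¹)
        fun s a => X_pow_dvd_mul_succ _ _ _, Fin.prod_univ_succ, Fin.prod_univ_succ, mul_assoc,
      ← Finset.prod_mul_distrib]
    rfl
  rw [tsum_congr h, tsum_pi_prod hg, Fin.prod_univ_succ]
  congr 1
  exact Finset.prod_congr rfl fun s _ => tsum_eulerSum_mul _ _

theorem binomialSum_eq (c N : ℕ) :
    binomialSum c N =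
      qPoch c * (qPoch N * (qPoch (N + c))⁻¹) * (1 - X ^ (N + c + 1))⁻¹ := by
  refine mul_right_cancel₀ (qPoch_ne_zero (N + c + 1)) ?_
  rw [binomialSum_mul, qPoch_succ]
  linear_combination (-qPoch c * qPoch N) * qPoch_mul_inv (N + c) -
    qPoch c * qPoch N * qPoch (N + c) * (qPoch (N + c))⁻¹ * one_sub_X_pow_mul_inv (N + c)

theorem qPoch_mul_prod_ratio (f : ℕ → ℕ) (k : ℕ) :
    qPoch (f 0) * ∏ s ∈ Finset.range k, (qPoch (f (s + 1)) * (qPoch (f s))⁻¹) = qPoch (f k) := by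
  induction k with
  | zero => simp
  | succ k ih =>
    rw [Finset.prod_range_succ, ← mul_assoc, ih]
    linear_combination qPoch (f (k + 1)) * qPoch_mul_inv (f k)

/-- The Pochhammer symbols of the tails telescope, those of the entries of `c` cancel. -/
theorem leaflessSum_eq {k : ℕ} (c : Fin (k + 1) → ℕ) :
    (X ^ tailSum c 0 * ∏ t, (qPoch (c t))⁻¹) * (eulerSum (tailSum c 0) *
      ∏ s : Fin k, eulerSum 0 * binomialSum (c s.castSucc) (tailSum c (s + 1))) =
    eulerSum 0 ^ (k + 1) *
      (X ^ tailSum c 0 * ∏ s : Fin k, (1 - X ^ (tailSum c s + 1))⁻¹) := by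
  have h1 (s : Fin k) : binomialSum (c s.castSucc) (tailSum c (s + 1)) =
      qPoch (c s.castSucc) * (qPoch (tailSum c (s + 1)) * (qPoch (tailSum c s))⁻¹) *
        (1 - X ^ (tailSum c s + 1))⁻¹ := by
    rw [binomialSum_eq, tailSum_castSucc, add_comm (c s.castSucc)]
  have h2 : qPoch (tailSum c 0) *
      ∏ s : Fin k, (qPoch (tailSum c (s + 1)) * (qPoch (tailSum c s))⁻¹) =
        qPoch (c (Fin.last k)) := by
    rw [← tailSum_last c, ← qPoch_mul_prod_ratio (tailSum c) k, Finset.prod_range]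
  have h3 : (∏ t, (qPoch (c t))⁻¹) * ((∏ s : Fin k, qPoch (c s.castSucc)) *
      qPoch (c (Fin.last k))) = 1 := by
    rw [← Fin.prod_univ_castSucc fun t => qPoch (c t), ← prod_inv, mul_comm]
    exact PowerSeries.mul_inv_cancel _ (by simp [map_prod, constantCoeff_qPoch])
  simp only [h1, Finset.prod_mul_distrib, Finset.prod_const, Finset.card_univ, Fintype.card_fin]
  rw [Finset.prod_mul_distrib] at h2
  rw [eulerSum_eq_mul (tailSum c 0)]
  rw [← h2] at h3
  linear_combination (X ^ tailSum c 0 * eulerSum 0 ^ (k + 1) *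
    ∏ s : Fin k, (1 - X ^ (tailSum c s + 1))⁻¹) * h3

theorem graphSeries_leafless (k : ℕ) :
    graphSeries (leafless k) = eulerSum 0 ^ (k + 1) * ∑' e, chainSum k e := by
  have hc (c : Fin (k + 1) → ℕ) :
      X ^ (∑ t, c t) ∣ X ^ tailSum c 0 * ∏ s : Fin k, ((1 : ℚ⟦X⟧) - X ^ (tailSum c s + 1))⁻¹ := by
    rw [tailSum_zero]
    exact dvd_mul_right _ _
  have hb (c b : Fin (k + 1) → ℕ) : X ^ (∑ s, b s) ∣ ∑' a : Fin k → ℕ,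
      (∏ s, X ^ (b s * (tailSum c s + 1)) * (qPoch (b s))⁻¹) *
        ∏ s, X ^ (a s * (b s.succ + c s.castSucc + 1)) * (qPoch (a s))⁻¹ :=
    X_pow_dvd_tsum (coeffFinite_pi fun a => (X_pow_sum_dvd_prod a _ _).mul_left _).summable
      fun a => (X_pow_sum_dvd_prod b _ _).mul_right _
  rw [graphSeries_eq (leafless k) (Equiv.ofBijective _ (leaflessLabel_bijective k))
    (leaflessWeight k) (leaflessWeight_spec k),
    tsum_sumArrow fun n => (pow_dvd_pow _ (Nat.le_add_left _ _)).mul_right _]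
  have h (c : Fin (k + 1) → ℕ) : ∑' v : Fin (k + 1) ⊕ Fin k → ℕ,
      (X : ℚ⟦X⟧) ^ (∑ x, ∑ y, leaflessWeight k x y * (Sum.elim c v x * Sum.elim c v y) +
        ∑ x, Sum.elim c v x) * ∏ x, (qPoch (Sum.elim c v x))⁻¹ =
      eulerSum 0 ^ (k + 1) *
        (X ^ tailSum c 0 * ∏ s : Fin k, (1 - X ^ (tailSum c s + 1))⁻¹) := by
    rw [tsum_sumArrow fun v => (pow_dvd_pow _ ?_).mul_right _, ← leaflessSum_eq,
      ← tsum_tsum_leafless, ← (coeffFinite_pi (hb c)).summable.tsum_mul_left]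
    · refine tsum_congr fun b => ?_
      rw [← (coeffFinite_pi fun a =>
        (X_pow_sum_dvd_prod a _ _).mul_left _).summable.tsum_mul_left]
      exact tsum_congr fun a => leaflessSummand_eq c b a
    · simp only [Fintype.sum_sum_type, Sum.elim_inl, Sum.elim_inr]
      omega
  rw [tsum_congr h, (coeffFinite_pi hc).summable.tsum_mul_left, tsum_snoc hc]
  congr 1
  refine tsum_congr fun e => tsum_congr fun c => ?_
  simp only [chainTerm, tailSum_snoc, Fin.is_le', if_true, Nat.zero_le, add_comm e]

/-! ### The star graph -/

/-- Labels of the vertices of `starGraph k`: the centre, its neighbours, and the ends of the long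
legs. -/
def starLabel (k : ℕ) : Unit ⊕ Fin (k + 1) ⊕ Fin k → Fin (2 * k + 2)
  | .inl _ => ⟨0, by omega⟩
  | .inr (.inl i) => ⟨2 * i + 1, by omega⟩
  | .inr (.inr i) => ⟨2 * i + 2, by omega⟩

theorem starLabel_bijective (k : ℕ) : Function.Bijective (starLabel k) := by
  refine (Fintype.bijective_iff_injective_and_card _).mpr ⟨?_, by simp; omega⟩
  rintro (x | x | x) (y | y | y) h <;>
    simp only [starLabel, Sum.inl.injEq, Sum.inr.injEq, reduceCtorEq, Fin.ext_iff] at h ⊢ <;> omega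

/-- Half of the adjacency matrix of `starGraph k`. -/
def starWeight (k : ℕ) : Unit ⊕ Fin (k + 1) ⊕ Fin k → Unit ⊕ Fin (k + 1) ⊕ Fin k → ℕ
  | .inl _, .inr (.inl _) => 1
  | .inr (.inr i), .inr (.inl j) => if i.castSucc = j then 1 else 0
  | _, _ => 0

theorem starGraph_adj_centre {k : ℕ} (u : Unit) (i : Fin (k + 1)) :
    (starGraph k).Adj (starLabel k (.inl u)) (starLabel k (.inr (.inl i))) := by
  simp only [starGraph, SimpleGraph.fromRel_adj, starLabel, ne_eq, Fin.mk.injEq, Finset.mem_Icc,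
    zero_add, true_and]
  refine ⟨by omega, .inl ?_⟩
  by_cases h : (i : ℕ) = k
  · exact .inr (by omega)
  · exact .inl ⟨i + 1, by omega, by omega⟩

theorem starGraph_adj_castSucc {k : ℕ} (i : Fin k) :
    (starGraph k).Adj (starLabel k (.inr (.inr i))) (starLabel k (.inr (.inl i.castSucc))) := by
  simp only [starGraph, SimpleGraph.fromRel_adj, starLabel, ne_eq, Fin.mk.injEq, Finset.mem_Icc,
    Fin.val_castSucc]
  exact ⟨by omega, .inr (.inl ⟨i + 1, by omega, by omega⟩)⟩

theorem starWeight_spec (k : ℕ) (x y) :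
    starWeight k x y + starWeight k y x = 1 ∧
      (starGraph k).Adj (starLabel k x) (starLabel k y) ∨
    starWeight k x y + starWeight k y x = 0 ∧
      ¬ (starGraph k).Adj (starLabel k x) (starLabel k y) := by
  have key : ∀ x y, (starGraph k).Adj (starLabel k x) (starLabel k y) →
      starWeight k x y + starWeight k y x = 1 := by
    intro x y hxy
    simp only [starGraph, SimpleGraph.fromRel_adj, ne_eq, Finset.mem_Icc] at hxy
    obtain ⟨hne, h⟩ := hxy
    rcases x with x | x | x <;> rcases y with y | y | y <;>
      simp only [starLabel, starWeight, Fin.ext_iff, Fin.val_castSucc, add_zero, zero_add]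
        at hne h ⊢ <;>
      rcases h with (⟨m, hm, h⟩ | h) | (⟨m, hm, h⟩ | h) <;>
      first | omega | (rw [if_pos]; omega)
  by_cases h : (starGraph k).Adj (starLabel k x) (starLabel k y)
  · exact .inl ⟨key x y h, h⟩
  · refine .inr ⟨?_, h⟩
    have h' := fun h' => h (SimpleGraph.Adj.symm h')
    rcases x with x | x | x <;> rcases y with y | y | y <;>
      simp only [starWeight, add_zero, zero_add]
    · exact (h (starGraph_adj_centre x y)).elim
    · exact (h' (starGraph_adj_centre y x)).elim
    · refine if_neg ?_
      rintro rfl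
      exact h' (starGraph_adj_castSucc _)
    · refine if_neg ?_
      rintro rfl
      exact h (starGraph_adj_castSucc _)

/-- The summand of the graph series of `starGraph k`, with the powers of `q` distributed over the
factors. -/
theorem starSummand_eq {k : ℕ} (u : Unit → ℕ) (m : Fin (k + 1) → ℕ) (e : Fin k → ℕ) :
    (X : ℚ⟦X⟧) ^ (∑ x, ∑ y, starWeight k x y *
        (Sum.elim u (Sum.elim m e) x * Sum.elim u (Sum.elim m e) y) +
        ∑ x, Sum.elim u (Sum.elim m e) x) *
      ∏ x, (qPoch (Sum.elim u (Sum.elim m e) x))⁻¹ =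
    (X ^ u () * (qPoch (u ()))⁻¹) *
      ((∏ i, X ^ (m i * (u () + 1)) * (qPoch (m i))⁻¹) *
        ∏ i, X ^ (e i * (m i.castSucc + 1)) * (qPoch (e i))⁻¹) := by
  have h : ∑ x, ∑ y, starWeight k x y *
        (Sum.elim u (Sum.elim m e) x * Sum.elim u (Sum.elim m e) y) +
        ∑ x, Sum.elim u (Sum.elim m e) x =
      u () + (∑ i, m i * (u () + 1) + ∑ i, e i * (m i.castSucc + 1)) := by
    simp only [Fintype.sum_sum_type, Sum.elim_inl, Sum.elim_inr, starWeight, zero_mul,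
      Finset.sum_const_zero, zero_add, add_zero, ite_mul, one_mul, Finset.sum_ite_eq,
      Finset.mem_univ, if_true, mul_add, mul_one, Finset.sum_add_distrib, Finset.univ_unique,
      Finset.sum_singleton, PUnit.default_eq_unit, mul_comm (u ())]
    ring
  rw [h, prod_X_pow_mul, prod_X_pow_mul]
  simp only [Fintype.prod_sum_type, Sum.elim_inl, Sum.elim_inr, Finset.univ_unique,
    Finset.prod_singleton, PUnit.default_eq_unit]
  ring

/-- The sum over the ends of the long legs, then over the neighbours of the centre; `N` is the
summation variable at the centre. -/
theorem tsum_tsum_star (k N : ℕ) :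
    ∑' m : Fin (k + 1) → ℕ, ∑' e : Fin k → ℕ,
      (∏ i, X ^ (m i * (N + 1)) * (qPoch (m i))⁻¹) *
        ∏ i, X ^ (e i * (m i.castSucc + 1)) * (qPoch (e i))⁻¹ =
    (eulerSum 0 * (1 - X ^ (N + 1))⁻¹) ^ k * eulerSum N := by
  -- the factors of the sum over `m`; the last neighbour is the short leg, with no end attached
  let g : Fin (k + 1) → ℕ → ℚ⟦X⟧ := Fin.snoc (α := fun _ => ℕ → ℚ⟦X⟧)
    (fun _ m => X ^ (m * (N + 1)) * (qPoch m)⁻¹ * eulerSum (m + 0))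
    (fun m => X ^ (m * (N + 1)) * (qPoch m)⁻¹)
  have hl : g (Fin.last k) = fun m => X ^ (m * (N + 1)) * (qPoch m)⁻¹ := Fin.snoc_last _ _
  have hs (i : Fin k) : g i.castSucc =
      fun m => X ^ (m * (N + 1)) * (qPoch m)⁻¹ * eulerSum (m + 0) := Fin.snoc_castSucc _ _ _
  have hg (i) (m) : X ^ m ∣ g i m := by
    refine Fin.lastCases ?_ (fun i => ?_) i
    · rw [hl]
      exact X_pow_dvd_mul_succ _ _ _
    · rw [hs]
      exact (X_pow_dvd_mul_succ _ _ _).mul_right _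
  have h (m : Fin (k + 1) → ℕ) : ∑' e : Fin k → ℕ,
      (∏ i, X ^ (m i * (N + 1)) * (qPoch (m i))⁻¹) *
        ∏ i, X ^ (e i * (m i.castSucc + 1)) * (qPoch (e i))⁻¹ = ∏ i, g i (m i) := by
    rw [(coeffFinite_pi fun e => X_pow_sum_dvd_prod e _ _).summable.tsum_mul_left,
      tsum_pi_prod (f := fun i e => X ^ (e * (m i.castSucc + 1)) * (qPoch e)⁻¹)
        fun i e => X_pow_dvd_mul_succ _ _ _, Fin.prod_univ_castSucc, Fin.prod_univ_castSucc,
      mul_right_comm, ← Finset.prod_mul_distrib, hl]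
    simp only [hs]
    rfl
  rw [tsum_congr h, tsum_pi_prod hg, Fin.prod_univ_castSucc, hl]
  simp only [hs, tsum_eulerSum_mul, binomialSum_zero, Finset.prod_const, Finset.card_univ,
    Fintype.card_fin]
  rfl

theorem pow_inv (f : ℚ⟦X⟧) (k : ℕ) : (f ^ k)⁻¹ = f⁻¹ ^ k := by
  simpa using prod_inv (Finset.range k) fun _ => f

theorem X_mul_graphSeries_starGraph (k : ℕ) :
    X * graphSeries (starGraph k) = eulerSum 0 ^ (k + 1) * qZeta k := by
  have hm (N : ℕ) (m : Fin (k + 1) → ℕ) : X ^ (∑ i, m i) ∣ ∑' e : Fin k → ℕ,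
      (∏ i, X ^ (m i * (N + 1)) * (qPoch (m i))⁻¹) *
        ∏ i, X ^ (e i * (m i.castSucc + 1)) * (qPoch (e i))⁻¹ :=
    X_pow_dvd_tsum (coeffFinite_pi fun e => (X_pow_sum_dvd_prod e _ _).mul_left _).summable
      fun e => (X_pow_sum_dvd_prod m _ _).mul_right _
  rw [graphSeries_eq (starGraph k) (Equiv.ofBijective _ (starLabel_bijective k))
    (starWeight k) (starWeight_spec k),
    tsum_sumArrow fun n => (pow_dvd_pow _ (Nat.le_add_left _ _)).mul_right _]
  have h (u : Unit → ℕ) : ∑' v : Fin (k + 1) ⊕ Fin k → ℕ,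
      (X : ℚ⟦X⟧) ^ (∑ x, ∑ y, starWeight k x y * (Sum.elim u v x * Sum.elim u v y) +
        ∑ x, Sum.elim u v x) * ∏ x, (qPoch (Sum.elim u v x))⁻¹ =
      X ^ u () * (eulerSum 0 ^ (k + 1) * ((1 - X ^ (u () + 1)) ^ k)⁻¹) := by
    rw [tsum_sumArrow fun v => (pow_dvd_pow _ ?_).mul_right _]
    · trans (X ^ u () * (qPoch (u ()))⁻¹) *
        ((eulerSum 0 * (1 - X ^ (u () + 1))⁻¹) ^ k * eulerSum (u ()))
      · rw [← tsum_tsum_star, ← (coeffFinite_pi (hm (u ()))).summable.tsum_mul_left]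
        refine tsum_congr fun m => ?_
        rw [← (coeffFinite_pi fun e =>
          (X_pow_sum_dvd_prod e _ _).mul_left _).summable.tsum_mul_left]
        exact tsum_congr fun e => starSummand_eq u m e
      · rw [eulerSum_eq_mul (u ()), pow_inv]
        linear_combination (X ^ u () * eulerSum 0 ^ (k + 1) * (1 - X ^ (u () + 1))⁻¹ ^ k) *
          qPoch_mul_inv (u ())
    · simp only [Fintype.sum_sum_type, Sum.elim_inl, Sum.elim_inr]
      omega
  rw [tsum_congr h, ← (Equiv.funUnique Unit ℕ).symm.tsum_eq, qZeta,
    ← (coeffFinite_nat fun n => ?_).summable.tsum_mul_left,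
    ← (summable_qZetaTerm k).tsum_mul_left]
  · refine tsum_congr fun n => ?_
    simp only [qZetaTerm, Equiv.funUnique_symm_apply, uniqueElim_const]
    ring
  · exact dvd_mul_right _ _

/-! ### The two forms of the `q`-zeta value -/

theorem summable_mul_X_pow_mul (c : ℕ → ℚ⟦X⟧) (N : ℕ) :
    Summable fun j => c j * X ^ (j * (N + 1)) :=
  (coeffFinite_nat fun j => (pow_dvd_pow _ (Nat.le_mul_of_pos_right j N.succ_pos)).mul_left
    _).summable

/-- The negative binomial series at `q^{N + 1}`. -/
theorem inv_one_sub_X_pow_pow (k N : ℕ) :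
    ((1 - X ^ (N + 1) : ℚ⟦X⟧) ^ k)⁻¹ =
      ∑' j : ℕ, C (k.multichoose j : ℚ) * X ^ (j * (N + 1)) := by
  induction k with
  | zero =>
    rw [tsum_eq_single 0]
    · simp
    · intro n hn
      obtain ⟨m, rfl⟩ := Nat.exists_eq_succ_of_ne_zero hn
      simp
  | succ k ih =>
    have h0 := summable_mul_X_pow_mul (fun j => C (k.multichoose j : ℚ)) N
    have h1 := summable_mul_X_pow_mul (fun j => C ((k + 1).multichoose j : ℚ)) N
    refine mul_left_cancel₀ (one_sub_X_pow_ne_zero N) ?_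
    rw [pow_succ _ k, PowerSeries.mul_inv_rev, ← mul_assoc, one_sub_X_pow_mul_inv, one_mul, ih, sub_mul,
      one_mul, h0.tsum_eq_zero_add, ← h1.tsum_mul_left, h1.tsum_eq_zero_add, add_sub_assoc,
      ← ((summable_nat_add_iff 1).mpr h1).tsum_sub (h1.mul_left _)]
    simp only [Nat.multichoose_zero_right]
    congr 1
    refine tsum_congr fun n => ?_
    rw [Nat.multichoose_succ_succ]
    push_cast
    rw [map_add]
    ring

theorem qZeta_eq_qZetaLambert {k : ℕ} (hk : 1 ≤ k) : qZeta k = qZetaLambert k := by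
  have hc : CoeffFinite (Function.uncurry fun n j : ℕ =>
      C (k.multichoose j : ℚ) * X ^ ((n + 1) * (j + 1))) :=
    coeffFinite_nat_prod fun n j => (pow_dvd_pow _ (by ring_nf; omega)).mul_left _
  calc qZeta k = ∑' n : ℕ, ∑' j : ℕ, C (k.multichoose j : ℚ) * X ^ ((n + 1) * (j + 1)) := by
        refine tsum_congr fun n => ?_
        rw [qZetaTerm, inv_one_sub_X_pow_pow, ← (summable_mul_X_pow_mul _ n).tsum_mul_left]
        exact tsum_congr fun j => by ring
    _ = ∑' j : ℕ, ∑' n : ℕ, C (k.multichoose j : ℚ) * X ^ ((n + 1) * (j + 1)) := hc.tsum_comm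
    _ = qZetaLambert k := by
        refine tsum_congr fun j => ?_
        rw [qZetaLambertTerm, ← tsum_X_pow_mul, ← multichoose_eq_choose hk,
          ← (coeffFinite_nat fun n => pow_dvd_pow _
            (Nat.le_mul_of_pos_right n (Nat.add_one_pos j))).summable.tsum_mul_left]
        exact tsum_congr fun n => by ring

/-! ### The logarithmic derivative of MacMahon's series -/

theorem X_mul_derivative_one_sub_X_pow_pow (n c : ℕ) :
    X * d⁄dX ℚ ((1 - X ^ (n + 1)) ^ c) =
      -((1 - X ^ (n + 1)) ^ c * (C (((n + 1) * c : ℕ) : ℚ) * X ^ (n + 1) *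
        (1 - X ^ (n + 1))⁻¹)) := by
  cases c with
  | zero => simp
  | succ c =>
    rw [map_natCast, Derivation.leibniz_pow, map_sub, Derivation.leibniz_pow, derivative_X]
    simp only [Derivation.map_one_eq_zero, smul_eq_mul, nsmul_eq_mul, Nat.add_sub_cancel]
    push_cast
    linear_combination (((n : ℚ⟦X⟧) + 1) * (c + 1) * X ^ (n + 1) * (1 - X ^ (n + 1)) ^ c) *
      one_sub_X_pow_mul_inv n

theorem X_mul_derivative_prod (c : ℕ → ℕ) (N : ℕ) :
    X * d⁄dX ℚ (∏ n ∈ Finset.range N, (1 - X ^ (n + 1)) ^ c n) =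
      -((∏ n ∈ Finset.range N, (1 - X ^ (n + 1)) ^ c n) *
        ∑ n ∈ Finset.range N, C (((n + 1) * c n : ℕ) : ℚ) * X ^ (n + 1) *
          (1 - X ^ (n + 1))⁻¹) := by
  induction N with
  | zero => simp
  | succ N ih =>
    rw [Finset.prod_range_succ, Finset.sum_range_succ, Derivation.leibniz, smul_eq_mul, smul_eq_mul]
    have h := X_mul_derivative_one_sub_X_pow_pow N (c N)
    linear_combination (∏ n ∈ Finset.range N, (1 - X ^ (n + 1)) ^ c n) * h +
      (1 - X ^ (N + 1)) ^ c N * ih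

theorem continuous_derivative : Continuous (d⁄dX ℚ) := by
  refine continuous_iff_continuousAt.mpr fun f =>
    (WithPiTopology.tendsto_iff_coeff_tendsto _ _ _ _).mpr fun n => ?_
  simp only [coeff_derivative]
  exact ((WithPiTopology.continuous_coeff ℚ (n + 1)).tendsto f).mul_const _

theorem macMahonNumerator_eq_qLogDeriv (k : ℕ) :
    macMahonNumerator k = qLogDeriv (macMahon k) := by
  set c : ℕ → ℕ := fun n => (n + k - 1).choose (k - 1)
  set P : ℚ⟦X⟧ := ∏' n : ℕ, (1 - X ^ (n + 1)) ^ c n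
  have h1 : Filter.Tendsto (fun N => ∏ n ∈ Finset.range N, ((1 : ℚ⟦X⟧) - X ^ (n + 1)) ^ c n)
      Filter.atTop (nhds P) := (multipliable_one_sub_X_pow_pow c).hasProd.tendsto_prod_nat
  have h2 := (summable_macMahonNumeratorTerm k).hasSum.tendsto_sum_nat
  have h3 : X * d⁄dX ℚ P = -(P * macMahonNumerator k) := by
    refine tendsto_nhds_unique (((continuous_derivative.tendsto P).comp h1).const_mul X) ?_
    refine (h1.mul h2).neg.congr fun N => ?_
    exact (X_mul_derivative_prod c N).symm
  have h4 : constantCoeff P = 1 := by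
    refine tendsto_nhds_unique
      (((WithPiTopology.continuous_constantCoeff ℚ).tendsto P).comp h1) ?_
    refine tendsto_const_nhds.congr fun N => ?_
    simp [map_prod]
  have h5 : P * P⁻¹ = 1 := PowerSeries.mul_inv_cancel _ (by simp [h4])
  have h6 : (P⁻¹)⁻¹ = P := by
    rw [eq_comm, PowerSeries.eq_inv_iff_mul_eq_one (by simp [h4]), h5]
  have h7 : macMahon k = P⁻¹ := rfl
  rw [qLogDeriv, h7, h6, derivative_inv']
  linear_combination (P * P⁻¹ ^ 2) * h3 - macMahonNumerator k * (1 + P * P⁻¹) * h5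

/-! ### Laurent series -/

theorem laurentSeries_eq_of_X_mul_eq {H N : ℚ⟦X⟧} {k : ℕ} (h : X * H = eulerSum 0 ^ (k + 1) * N) :
    (H : LaurentSeries ℚ) = ((X : ℚ⟦X⟧) : LaurentSeries ℚ)⁻¹ *
      ((N : LaurentSeries ℚ) / (qPochInf : LaurentSeries ℚ) ^ (k + 1)) := by
  have hX : ((X : ℚ⟦X⟧) : LaurentSeries ℚ) ≠ 0 := by simp
  have hP : (qPochInf : LaurentSeries ℚ) ≠ 0 :=
    (map_ne_zero_iff _ HahnSeries.ofPowerSeries_injective).mpr qPochInf_ne_zero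
  have h1 : X * H * qPochInf ^ (k + 1) = N := by
    rw [h, mul_right_comm, ← mul_pow, eulerSum_zero_mul_qPochInf, one_pow, one_mul]
  have h2 := congrArg (fun f : ℚ⟦X⟧ => (f : LaurentSeries ℚ)) h1
  simp only [PowerSeries.coe_mul, PowerSeries.coe_pow] at h2
  rw [← h2]
  field_simp

end GraphSeries

/-- In the field `ℚ⸨X⸩` of Laurent series, `X⁻¹` and the quotients are genuine. -/
theorem theorem1p1 :
    (∀ k : ℕ, 1 ≤ k →
      (GraphSeries.graphSeries (GraphSeries.leafless k) : LaurentSeries ℚ) =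
        ((PowerSeries.X : PowerSeries ℚ) : LaurentSeries ℚ)⁻¹ *
          ((GraphSeries.macMahonNumerator k : LaurentSeries ℚ) /
            (GraphSeries.qPochInf : LaurentSeries ℚ) ^ (k + 1)) ∧
      GraphSeries.macMahonNumerator k = GraphSeries.qLogDeriv (GraphSeries.macMahon k)) ∧
    (∀ k : ℕ, 2 ≤ k →
      (GraphSeries.graphSeries (GraphSeries.starGraph k) : LaurentSeries ℚ) =
        ((PowerSeries.X : PowerSeries ℚ) : LaurentSeries ℚ)⁻¹ *
          ((GraphSeries.qZeta k : LaurentSeries ℚ) /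
            (GraphSeries.qPochInf : LaurentSeries ℚ) ^ (k + 1)) ∧
      GraphSeries.qZeta k = GraphSeries.qZetaLambert k) := by
  refine ⟨fun k hk => ⟨?_, ?_⟩, fun k hk => ⟨?_, ?_⟩⟩
  · refine GraphSeries.laurentSeries_eq_of_X_mul_eq ?_
    rw [GraphSeries.graphSeries_leafless, ← GraphSeries.X_mul_tsum_chainSum hk]
    ring
  · exact GraphSeries.macMahonNumerator_eq_qLogDeriv k
  · exact GraphSeries.laurentSeries_eq_of_X_mul_eq (GraphSeries.X_mul_graphSeries_starGraph k)
  · exact GraphSeries.qZeta_eq_qZetaLambert (by omega)
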